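/- **Setting.** Let $\xi$ be a measure on $\mathbb{R}$, $\Theta\subseteq\mathbb{R}$ an open interval, and $\{\nu_\theta:\theta\in\Theta\}$ the one-parameter canonical exponential family of probability measures with densities $x\mapsto\exp(\theta x-b(\theta))$ with respect to $\xi$. The mean of $\nu_\theta$ is $\dot b(\theta)$; put $\mathrm{J}=\dot b(\Theta)$ and, for $\mu\in\mathrm{J}$, write $\nu^\mu$ for the member of the family with mean $\mu$. For $\mu,\mu'\in\mathrm{J}$ let $d(\mu,\mu')=\mathrm{KL}(\nu^\mu,\nu^{\mu'})$; for an arbitrary real $x$ and $q=\dot b(\eta)\in\mathrm{J}$ let $$d(x,q)=\sup_{\theta\in\Theta}\big[(\theta x-b(\theta))-(\eta x-b(\eta))\big]\in[0,\infty],$$ which agrees with the former for $x\in\mathrm{J}$. A bandit has $K$ arms with parameters $\theta_1,\dots,\theta_K\in\Theta$ and means $\mu_a=\dot b(\theta_a)$, $\mu^*=\max_a\mu_a$. The rewards $(Y_{a,s})_{a\le K,\,s\ge1}$ are independent and $Y_{a,s}\sim\nu_{\theta_a}$. If $A_t$ is the arm drawn at round $t$, let $N_a(t)=\sum_{s=1}^t\mathbf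 1_{(A_s=a)}$ and let $\hat\mu_a(t)=\frac1{N_a(t)}\sum_{k=1}^{N_a(t)}Y_{a,k}$ be the empirical mean of arm $a$ after $t$ rounds ($0$ if $N_a(t)=0$). For $c\ge0$ and a horizon $T$ define the indices, with values in $[-\infty,\infty]$, $$u_a^{+}(t)=\sup\Big\{q\in\mathrm{J}: N_a(t)\,d(\hat\mu_a(t),q)\le\log\frac{t\log^c t}{N_a(t)}\Big\},\qquad u_a^{H,+}(t)=\sup\Big\{q\in\mathrm{J}: N_a(t)\,d(\hat\mu_a(t),q)\le\log\frac{T\log^c T}{N_a(t)}\Big\}.$$ The policy kl-UCB$^+$ (respectively kl-UCB-H$^+$ with horizon $T$) draws each arm once in the first $K$ rounds and then, for $t\ge K$ (respectively $K\le t<T$), draws an arm $A_{t+1}$ that maximises $u_a^+(t)$ (respectively $u_a^{H,+}(t)$) over $a$, ties being broken arbitrarily (measurably). **Theorem 2.** Let $c\ge7$ and let $a$ be a suboptimal arm, $\mu_a<\mu^*$. For every $\varepsilon>0$ there is a constant $C$, depending only on $\varepsilon$, $c$, $a$, the exponential family and $(\theta_1,\dots,\theta_K)$, such that for every horizon $T\ge2$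 both kl-UCB$^+$ and kl-UCB-H$^+$ (run with horizon $T$) satisfy $$\mathbb{E}[N_a(T)]\le\frac{1+\varepsilon}{d(\mu_a,\mu^*)}\log T+C\sqrt{\log T}.$$ Consequently both policies are asymptotically optimal, in the sense that $$\limsup_{T\to\infty}\frac{\mathbb{E}[N_a(T)]}{\log T}\le\frac1{d(\mu_a,\mu^*)}\quad\text{for every suboptimal arm } a .$$ -/

import Mathlib

open MeasureTheory ProbabilityTheory Filter

universe u

noncomputable section

/-- A one-parameter canonical exponential family on `ℝ`: a reference measure `ξ`, an open interval
`Θ` of natural parameters (open and order-connected; it need not be the largest possible one), and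
a log-partition function `b` such that `x ↦ exp (θ x - b θ)` is a probability density with respect
to `ξ` for each `θ ∈ Θ`.  The normalisation forces `b θ = log ∫ exp (θ x) dξ(x)` on `Θ`
(`ExpFamily.b_eq_cgf`), so that `b` is automatically convex and smooth on `Θ`. -/
structure ExpFamily where
  /-- the reference measure -/
  ξ : Measure ℝ
  /-- the natural parameters -/
  Θ : Set ℝ
  /-- the log-partition function -/
  b : ℝ → ℝ
  isOpen_Θ : IsOpen Θ
  ordConnected_Θ : Θ.OrdConnected
  isProbability : ∀ θ ∈ Θ,
    IsProbabilityMeasure (ξ.withDensity fun x => ENNReal.ofReal (Real.exp (θ * x - b θ)))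

namespace ExpFamily

variable (F : ExpFamily)

/-- The member `ν_θ` of the family, with density `exp (θ x - b θ)` with respect to `ξ`. -/
def dist (θ : ℝ) : Measure ℝ :=
  F.ξ.withDensity fun x => ENNReal.ofReal (Real.exp (θ * x - F.b θ))

/-- The mean parameter `μ = ḃ(θ)`; it is the expectation of `ν_θ` for `θ ∈ Θ`
(`ExpFamily.integral_id_dist`). -/
def mean (θ : ℝ) : ℝ := deriv F.b θ

/-- The divergence `d(x, ḃ(η))`, for an arbitrary real first argument `x` (an empirical mean) and
a distribution `ν_η` of the family, with values in the extended reals: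
`sup_{θ ∈ Θ} [(θ x - b θ) - (η x - b η)]`.
If `x = ḃ(θ)` with `θ ∈ Θ`, this is `KL(ν_θ, ν_η)`, see `ExpFamily.div_mean` and
`ExpFamily.klDiv_dist`; an empirical mean may however fall outside `ḃ(Θ)` (for instance it may
be `0` or `1` for Bernoulli rewards), where this is the usual extension by limits. -/
def div (x η : ℝ) : EReal :=
  ⨆ θ ∈ F.Θ, (((θ * x - F.b θ) - (η * x - F.b η) : ℝ) : EReal)

/-- `sup {q ∈ ḃ(Θ) : n d(x, q) ≤ δ}`, in the extended reals; the means `q ∈ ḃ(Θ)` are written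
`q = ḃ(η)` with `η ∈ Θ`. -/
def klIndex (n : ℕ) (x δ : ℝ) : EReal :=
  sSup {q : EReal | ∃ η ∈ F.Θ, q = (F.mean η : EReal) ∧ (n : EReal) * F.div x η ≤ (δ : EReal)}

end ExpFamily

/-- `Y a s` is the `(s+1)`-st reward of arm `a`.  All rewards are independent, and those of arm
`a` have law `ν_{θ_a}`. -/
structure IsBandit (F : ExpFamily) {K : ℕ} (θ : Fin K → ℝ) {Ω : Type*} [MeasurableSpace Ω]
    (P : Measure Ω) (Y : Fin K → ℕ → Ω → ℝ) : Prop where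
  measurable : ∀ a s, Measurable (Y a s)
  indep : iIndepFun (fun p : Fin K × ℕ => Y p.1 p.2) P
  law : ∀ a s, P.map (Y a s) = F.dist (θ a)

section Policies

variable {K : ℕ} {Ω : Type*}

/-- `N_a(t)`, the number of draws of arm `a` in rounds `1, …, t`; `A s` is the arm drawn in
round `s`. -/
def pulls (A : ℕ → Ω → Fin K) (a : Fin K) (t : ℕ) (ω : Ω) : ℕ :=
  ((Finset.Icc 1 t).filter fun s => A s ω = a).card

/-- `μ̂_a(t)`, the mean of the first `N_a(t)` rewards of arm `a` (`0` if `N_a(t) = 0`). -/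
def empMean (Y : Fin K → ℕ → Ω → ℝ) (A : ℕ → Ω → Fin K) (a : Fin K) (t : ℕ) (ω : Ω) : ℝ :=
  (∑ k ∈ Finset.range (pulls A a t ω), Y a k ω) / (pulls A a t ω : ℝ)

/-- Up to round `n`, the arms `A` are chosen by the index policy with indices `u`: the first `K`
rounds draw each arm once, and for `K ≤ t < n` the arm `A (t + 1)` is one of those that maximise
`u · t`, ties being broken arbitrarily. -/
structure FollowsIndex (u : Fin K → ℕ → Ω → EReal) (A : ℕ → Ω → Fin K) (n : ℕ) : Prop where
  init : K ≤ n → ∀ a ω, pulls A a K ω = 1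
  greedy : ∀ t, K ≤ t → t < n → ∀ ω a, u a t ω ≤ u (A (t + 1) ω) t ω

/-- The kl-UCB⁺ index `u_a⁺(t)`, with exploration rate `log (t log^c t / N_a(t))`. -/
def klUCBPlusIndex (F : ExpFamily) (c : ℝ) (Y : Fin K → ℕ → Ω → ℝ) (A : ℕ → Ω → Fin K)
    (a : Fin K) (t : ℕ) (ω : Ω) : EReal :=
  F.klIndex (pulls A a t ω) (empMean Y A a t ω)
    (Real.log ((t : ℝ) * Real.log t ^ c / (pulls A a t ω : ℝ)))

/-- The kl-UCB-H⁺ index `u_a^{H,+}(t)` for the horizon `T`, with exploration rate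
`log (T log^c T / N_a(t))`. -/
def klUCBHPlusIndex (F : ExpFamily) (c : ℝ) (T : ℕ) (Y : Fin K → ℕ → Ω → ℝ)
    (A : ℕ → Ω → Fin K) (a : Fin K) (t : ℕ) (ω : Ω) : EReal :=
  F.klIndex (pulls A a t ω) (empMean Y A a t ω)
    (Real.log ((T : ℝ) * Real.log T ^ c / (pulls A a t ω : ℝ)))

end Policies

/-! Checks that the definitions above are the intended ones. -/

namespace ExpFamily

variable (F : ExpFamily) {θ η : ℝ}

lemma ofReal_exp_eq (θ x : ℝ) : ENNReal.ofReal (Real.exp (θ * x - F.b θ)) =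
    ENNReal.ofReal (Real.exp (-F.b θ)) * ENNReal.ofReal (Real.exp (θ * x)) := by
  rw [← ENNReal.ofReal_mul (Real.exp_pos _).le, ← Real.exp_add]
  congr 2
  ring

lemma lintegral_exp (hθ : θ ∈ F.Θ) :
    ∫⁻ x, ENNReal.ofReal (Real.exp (θ * x)) ∂F.ξ = ENNReal.ofReal (Real.exp (F.b θ)) := by
  have h := (F.isProbability θ hθ).measure_univ
  rw [withDensity_apply _ MeasurableSet.univ, Measure.restrict_univ] at h
  simp_rw [F.ofReal_exp_eq] at h
  rw [lintegral_const_mul _ (by fun_prop)] at h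
  have h2 : ENNReal.ofReal (Real.exp (F.b θ)) * ENNReal.ofReal (Real.exp (-F.b θ)) = 1 := by
    rw [← ENNReal.ofReal_mul (Real.exp_pos _).le, ← Real.exp_add]
    simp
  calc _ = ENNReal.ofReal (Real.exp (F.b θ)) * ENNReal.ofReal (Real.exp (-F.b θ)) *
        ∫⁻ x, ENNReal.ofReal (Real.exp (θ * x)) ∂F.ξ := by rw [h2, one_mul]
    _ = _ := by rw [mul_assoc, h, mul_one]

lemma integrable_exp (hθ : θ ∈ F.Θ) : Integrable (fun x => Real.exp (θ * x)) F.ξ := by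
  refine ⟨by fun_prop, ?_⟩
  rw [hasFiniteIntegral_iff_ofReal (Eventually.of_forall fun x => (Real.exp_pos _).le),
    F.lintegral_exp hθ]
  exact ENNReal.ofReal_lt_top

lemma integral_exp (hθ : θ ∈ F.Θ) : ∫ x, Real.exp (θ * x) ∂F.ξ = Real.exp (F.b θ) := by
  rw [integral_eq_lintegral_of_nonneg_ae (Eventually.of_forall fun x => (Real.exp_pos _).le)
    (by fun_prop), F.lintegral_exp hθ, ENNReal.toReal_ofReal (Real.exp_pos _).le]

/-- On `Θ`, the function `b` is the cumulant generating function of `ξ`. -/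
lemma b_eq_cgf (hθ : θ ∈ F.Θ) : F.b θ = cgf id F.ξ θ := by
  simp [cgf, mgf, F.integral_exp hθ]

lemma subset_interior : F.Θ ⊆ interior (integrableExpSet id F.ξ) :=
  interior_maximal (fun _ h => F.integrable_exp h) F.isOpen_Θ

/-- The distribution `ν_θ` is the exponential tilting of `ξ` by `θ`. -/
lemma dist_eq_tilted (hθ : θ ∈ F.Θ) : F.dist θ = F.ξ.tilted fun x => θ * x := by
  simp only [dist, Measure.tilted, F.integral_exp hθ, Real.exp_sub]

/-- The mean of `ν_θ` is `ḃ(θ)`. -/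
lemma integral_id_dist (hθ : θ ∈ F.Θ) : ∫ x, x ∂(F.dist θ) = F.mean θ := by
  have h1 : deriv F.b θ = deriv (cgf id F.ξ) θ := by
    apply Filter.EventuallyEq.deriv_eq
    filter_upwards [F.isOpen_Θ.mem_nhds hθ] with y hy using F.b_eq_cgf hy
  rw [mean, h1, F.dist_eq_tilted hθ]
  exact integral_tilted_mul_self (X := id) (F.subset_interior hθ)

lemma integrable_id_dist (hθ : θ ∈ F.Θ) : Integrable (fun x => x) (F.dist θ) := by
  rw [F.dist_eq_tilted hθ]
  have := memLp_tilted_mul (X := id) (F.subset_interior hθ) 1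
  exact memLp_one_iff_integrable.1 (by exact_mod_cast this)

lemma dist_eq_tilted_dist (hθ : θ ∈ F.Θ) (hη : η ∈ F.Θ) :
    F.dist η = (F.dist θ).tilted fun x => (η - θ) * x := by
  rw [F.dist_eq_tilted hθ, F.dist_eq_tilted hη, tilted_tilted (F.integrable_exp hθ)]
  congr 1
  funext x
  simp only [Pi.add_apply]
  ring

/-- The closed form of the Kullback-Leibler divergence:
`KL(ν_θ, ν_η) = ḃ(θ) (θ - η) - b(θ) + b(η)`. -/
theorem klDiv_dist (hθ : θ ∈ F.Θ) (hη : η ∈ F.Θ) :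
    InformationTheory.klDiv (F.dist θ) (F.dist η) ≠ ⊤ ∧
    (InformationTheory.klDiv (F.dist θ) (F.dist η)).toReal =
      F.mean θ * (θ - η) - F.b θ + F.b η := by
  have : IsProbabilityMeasure (F.dist θ) := F.isProbability θ hθ
  have : IsProbabilityMeasure (F.dist η) := F.isProbability η hη
  have hint : Integrable (fun x => Real.exp ((η - θ) * x)) (F.dist θ) := by
    rw [F.dist_eq_tilted hθ, integrable_tilted_iff (F.integrable_exp hθ)]
    refine (F.integrable_exp hη).congr (Eventually.of_forall fun x => ?_)
    simp only [smul_eq_mul, ← Real.exp_add]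
    congr 1
    ring
  have hlog : ∫ x, Real.exp ((η - θ) * x) ∂(F.dist θ) = Real.exp (F.b η - F.b θ) := by
    rw [F.dist_eq_tilted hθ, integral_exp_tilted, F.integral_exp hθ, Real.exp_sub,
      ← F.integral_exp hη]
    congr 2
    funext x
    simp only [Pi.add_apply]
    congr 1
    ring
  have hid := F.integrable_id_dist hθ
  have h0 : Integrable (llr (F.dist θ) (F.dist θ)) (F.dist θ) := by
    rw [integrable_congr (llr_self _)]
    exact integrable_zero _ _ _
  have h00 : ∫ x, llr (F.dist θ) (F.dist θ) x ∂(F.dist θ) = 0 := by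
    rw [integral_congr_ae (llr_self _)]
    simp
  have hac : F.dist θ ≪ F.dist η := by
    rw [F.dist_eq_tilted_dist hθ hη]
    exact absolutelyContinuous_tilted hint
  have hI : Integrable (llr (F.dist θ) (F.dist η)) (F.dist θ) := by
    rw [F.dist_eq_tilted_dist hθ hη]
    exact integrable_llr_tilted_right Measure.AbsolutelyContinuous.rfl (hid.const_mul _) h0 hint
  refine ⟨InformationTheory.klDiv_ne_top hac hI, ?_⟩
  rw [InformationTheory.toReal_klDiv_of_measure_eq hac (by simp)]
  have key := integral_llr_tilted_right (μ := F.dist θ) (ν := F.dist θ)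
    Measure.AbsolutelyContinuous.rfl (hid.const_mul (η - θ)) hint h0
  rw [← F.dist_eq_tilted_dist hθ hη] at key
  rw [key, h00, hlog, Real.log_exp, integral_const_mul, F.integral_id_dist hθ]
  ring

/-- At a mean `x = ḃ(θ)` of the family, `div` is the Kullback-Leibler divergence. -/
theorem div_mean (hθ : θ ∈ F.Θ) (hη : η ∈ F.Θ) :
    F.div (F.mean θ) η =
      ((InformationTheory.klDiv (F.dist θ) (F.dist η)).toReal : EReal) := by
  rw [(F.klDiv_dist hθ hη).2, div]
  apply le_antisymm
  · refine iSup₂_le fun τ hτ => ?_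
    have h : (0 : ℝ) ≤ F.mean θ * (θ - τ) - F.b θ + F.b τ := by
      rw [← (F.klDiv_dist hθ hτ).2]
      exact ENNReal.toReal_nonneg
    exact EReal.coe_le_coe_iff.2 (by linarith)
  · refine le_trans (le_of_eq ?_) (le_iSup₂ (f := fun (τ : ℝ) (_ : τ ∈ F.Θ) =>
      (((τ * F.mean θ - F.b τ) - (η * F.mean θ - F.b η) : ℝ) : EReal)) θ hθ)
    congr 1
    ring

end ExpFamily

end

/-! Put parameters `ζ < η < η'` strictly between `θ a` and `θ aStar`. When a suboptimal arm `a` is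
drawn, one of three things holds: an index of the best arm lies below `F.mean η'`; the empirical
mean of `a` is at least `F.mean ζ`; or the index of `a` exceeds `F.mean η` although its empirical
mean is below `F.mean ζ`, which forces `N_a(t) * kl ζ η` to be at most the exploration rate
(`mul_kl_le_of_lt_klIndex`). Every draw of `a` uses a new value of `N_a`, so the last two cases are
counted over values of `N_a` rather than over rounds (`pulls_le_add_card`). The third gives the main
term `log V / kl ζ η`, the second a convergent series of Chernoff bounds.

The first case rests on `measure_klIndex_lt`: with `n` observations and rate `δ`, underestimation of
a mean strictly below the true one has probability at most `exp (-δ) * exp (-n κ)`, where `κ > 0`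
comes from the margin between `η'` and `θ aStar`. For `δ = log (v / n)` this is `(n / v) * exp (-n
κ)`. A union bound over `n` therefore costs only a constant over `v`, and `1 / v` has bounded sum
over the rounds, both for `v = t log^c t` and for `v = T log^c T`. Finally `kl ζ η` tends to the
true divergence as `ζ` and `η` approach the two arms, and `log log T` is absorbed into `√(log T)`.
-/

noncomputable section

open Topology

/-! ### Divergence, log-likelihood and index of an exponential family. -/

namespace ExpFamily

variable (F : ExpFamily) {θ η ζ x : ℝ}

/-- The closed form of `KL(ν_θ, ν_η)`. -/
def kl (θ η : ℝ) : ℝ := F.mean θ * (θ - η) - F.b θ + F.b η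

lemma toReal_klDiv (hθ : θ ∈ F.Θ) (hη : η ∈ F.Θ) :
    (InformationTheory.klDiv (F.dist θ) (F.dist η)).toReal = F.kl θ η :=
  (F.klDiv_dist hθ hη).2

lemma kl_nonneg (hθ : θ ∈ F.Θ) (hη : η ∈ F.Θ) : 0 ≤ F.kl θ η := by
  rw [← F.toReal_klDiv hθ hη]
  exact ENNReal.toReal_nonneg

/-- The symmetrised divergence `kl θ η + kl η θ` equals `(θ - η) * (F.mean θ - F.mean η)`, and it is
nonnegative. -/
lemma mean_mono (hθ : θ ∈ F.Θ) (hη : η ∈ F.Θ) (h : θ ≤ η) : F.mean θ ≤ F.mean η := by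
  rcases h.eq_or_lt with rfl | h
  · exact le_rfl
  have h1 := F.kl_nonneg hθ hη
  have h2 := F.kl_nonneg hη hθ
  unfold kl at h1 h2
  nlinarith

lemma lt_of_mean_lt (hθ : θ ∈ F.Θ) (hη : η ∈ F.Θ) (h : F.mean θ < F.mean η) : θ < η := by
  by_contra! h'
  exact absurd (F.mean_mono hη hθ h') (not_le.2 h)

/-- If two distinct parameters give the same distribution, all members of the family have the
same mean. -/
lemma mean_eq_of_dist_eq (hθ : θ ∈ F.Θ) (hne : θ ≠ η)
    (h : F.dist θ = F.dist η) (hζ : ζ ∈ F.Θ) :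
    F.mean ζ = (F.b θ - F.b η) / (θ - η) := by
  have := F.isProbability θ hθ
  have := F.isProbability ζ hζ
  have hfin : ∫⁻ x, ENNReal.ofReal (Real.exp (θ * x - F.b θ)) ∂F.ξ ≠ ⊤ := by
    have h1 := (F.isProbability θ hθ).measure_univ
    rw [withDensity_apply _ MeasurableSet.univ, Measure.restrict_univ] at h1
    simp [h1]
  have hae := (withDensity_eq_iff (by fun_prop) (by fun_prop) hfin).1 h
  have hx : ∀ᵐ x ∂F.ξ, x = (F.b θ - F.b η) / (θ - η) := by
    filter_upwards [hae] with x hx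
    rw [ENNReal.ofReal_eq_ofReal_iff (Real.exp_pos _).le (Real.exp_pos _).le,
      Real.exp_eq_exp] at hx
    rw [eq_div_iff (sub_ne_zero.2 hne)]
    linarith
  have hx' : ∀ᵐ x ∂(F.dist ζ), x = (F.b θ - F.b η) / (θ - η) :=
    (withDensity_absolutelyContinuous _ _).ae_le hx
  have : IsProbabilityMeasure (F.dist ζ) := F.isProbability ζ hζ
  rw [← F.integral_id_dist hζ, integral_congr_ae hx']
  simp

/-- Zero divergence would identify two distributions of the family, hence make the mean constant.
The pair `α`, `β` excludes this degenerate case (`ξ` carried by a single point). -/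
lemma kl_pos {α β : ℝ} (hα : α ∈ F.Θ) (hβ : β ∈ F.Θ) (hαβ : F.mean α < F.mean β)
    (hθ : θ ∈ F.Θ) (hη : η ∈ F.Θ) (hne : θ ≠ η) : 0 < F.kl θ η := by
  refine (F.kl_nonneg hθ hη).lt_of_ne fun h => ?_
  have : IsProbabilityMeasure (F.dist θ) := F.isProbability θ hθ
  have : IsProbabilityMeasure (F.dist η) := F.isProbability η hη
  rw [← F.toReal_klDiv hθ hη, eq_comm, ENNReal.toReal_eq_zero_iff,
    InformationTheory.klDiv_eq_zero_iff, or_iff_left (F.klDiv_dist hθ hη).1] at h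
  rw [F.mean_eq_of_dist_eq hθ hne h hα, F.mean_eq_of_dist_eq hθ hne h hβ] at hαβ
  exact lt_irrefl _ hαβ

lemma mean_lt {α β : ℝ} (hα : α ∈ F.Θ) (hβ : β ∈ F.Θ) (hαβ : F.mean α < F.mean β)
    (hθ : θ ∈ F.Θ) (hη : η ∈ F.Θ) (h : θ < η) : F.mean θ < F.mean η := by
  have h1 := F.kl_pos hα hβ hαβ hθ hη h.ne
  have h2 := F.kl_pos hα hβ hαβ hη hθ h.ne'
  unfold kl at h1 h2
  nlinarith

/-- `KL(ν_θ, ·)` is nondecreasing to the right of `θ`. -/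
lemma kl_mono_right {η' : ℝ} (hθ : θ ∈ F.Θ) (hη : η ∈ F.Θ) (hη' : η' ∈ F.Θ) (h1 : θ ≤ η)
    (h2 : η ≤ η') : F.kl θ η ≤ F.kl θ η' := by
  have h3 := F.kl_nonneg hη hη'
  -- Three-point identity: the difference is `kl η η' + (η' - η) * (F.mean η - F.mean θ)`.
  have h4 := F.mean_mono hθ hη h1
  unfold kl at *
  nlinarith

lemma analyticAt_b (hθ : θ ∈ F.Θ) : AnalyticAt ℝ F.b θ := by
  refine (analyticAt_cgf (X := id) (F.subset_interior hθ)).congr ?_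
  filter_upwards [F.isOpen_Θ.mem_nhds hθ] with y hy using (F.b_eq_cgf hy).symm

lemma continuousAt_b (hθ : θ ∈ F.Θ) : ContinuousAt F.b θ := (F.analyticAt_b hθ).continuousAt

lemma continuousAt_mean (hθ : θ ∈ F.Θ) : ContinuousAt F.mean θ :=
  (F.analyticAt_b hθ).deriv.continuousAt

lemma tendsto_kl (hθ : θ ∈ F.Θ) (hη : η ∈ F.Θ) :
    Tendsto (fun r => F.kl (θ + r) (η - r)) (𝓝 0) (𝓝 (F.kl θ η)) := by
  have h1 : Tendsto (fun r : ℝ => θ + r) (𝓝 0) (𝓝 θ) := by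
    exact Continuous.tendsto' (by fun_prop) _ _ (by simp)
  have h2 : Tendsto (fun r : ℝ => η - r) (𝓝 0) (𝓝 η) := by
    exact Continuous.tendsto' (by fun_prop) _ _ (by simp)
  exact (((((F.continuousAt_mean hθ).tendsto.comp h1).mul (h1.sub h2)).sub
    ((F.continuousAt_b hθ).tendsto.comp h1)).add ((F.continuousAt_b hη).tendsto.comp h2))

/-- The log-likelihood `θ x - b θ` of the parameter `θ`, up to a term that only depends on `x`. -/
def llh (x θ : ℝ) : ℝ := θ * x - F.b θ

/-- The concavity inequality of the log-likelihood. -/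
lemma llh_le (hθ : θ ∈ F.Θ) (hη : η ∈ F.Θ) :
    F.llh x η ≤ F.llh x θ + (η - θ) * (x - F.mean θ) := by
  have := F.kl_nonneg hθ hη
  unfold kl at this
  unfold llh
  linarith

lemma llh_sub_le_div (hθ : θ ∈ F.Θ) : ((F.llh x θ - F.llh x η : ℝ) : EReal) ≤ F.div x η :=
  le_iSup₂ (f := fun (θ : ℝ) (_ : θ ∈ F.Θ) =>
    (((θ * x - F.b θ) - (η * x - F.b η) : ℝ) : EReal)) θ hθ

lemma div_le {B : ℝ} (h : ∀ θ ∈ F.Θ, F.llh x θ - F.llh x η ≤ B) : F.div x η ≤ (B : EReal) :=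
  iSup₂_le fun θ hθ => EReal.coe_le_coe_iff.2 (h θ hθ)

lemma natCast_mul_div_le {n : ℕ} {B δ : ℝ} (h : ∀ θ ∈ F.Θ, F.llh x θ - F.llh x η ≤ B)
    (hB : n * B ≤ δ) : (n : EReal) * F.div x η ≤ (δ : EReal) := by
  refine (mul_le_mul_of_nonneg_left (F.div_le h) (by positivity)).trans ?_
  exact_mod_cast hB

lemma natCast_mul_llh_le {n : ℕ} {δ : ℝ} (h : (n : EReal) * F.div x η ≤ (δ : EReal))
    (hθ : θ ∈ F.Θ) : n * (F.llh x θ - F.llh x η) ≤ δ := by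
  have := (mul_le_mul_of_nonneg_left (F.llh_sub_le_div (x := x) (η := η) hθ)
    (by positivity : (0 : EReal) ≤ n)).trans h
  exact_mod_cast this

/-- If the log-likelihood is bounded, the index exceeds each mean that is at most `x`. -/
lemma mean_le_klIndex {n : ℕ} {δ : ℝ} (hη : η ∈ F.Θ) (hδ : 0 < δ) (hx : F.mean η ≤ x)
    (hb : BddAbove (F.llh x '' F.Θ)) : (F.mean η : EReal) ≤ F.klIndex n x δ := by
  -- The `+ 1` keeps the tolerance meaningful for `n = 0`, and `n * (δ / (n + 1)) ≤ δ`.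
  have hpos : 0 < δ / (n + 1) := by positivity
  obtain ⟨_, ⟨τ, hτ, rfl⟩, hlt⟩ :=
    exists_lt_of_lt_csSup ((Set.nonempty_of_mem hη).image (F.llh x))
      (sub_lt_self (sSup (F.llh x '' F.Θ)) hpos)
  -- A near-maximiser can be taken to the right of `η`: the concave log-likelihood has slope `x -
  -- F.mean η ≥ 0` at `η`, so points to the left do no better than `η`.
  have key : ∃ τ ∈ F.Θ, η ≤ τ ∧ sSup (F.llh x '' F.Θ) - δ / (n + 1) < F.llh x τ := by
    rcases le_total η τ with h | h
    · exact ⟨τ, hτ, h, hlt⟩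
    · refine ⟨η, hη, le_rfl, hlt.trans_le ?_⟩
      have := F.llh_le (x := x) hη hτ
      nlinarith
  obtain ⟨τ, hτ, hητ, hlt⟩ := key
  refine (EReal.coe_le_coe_iff.2 (F.mean_mono hη hτ hητ)).trans ?_
  refine le_sSup ⟨τ, hτ, rfl, F.natCast_mul_div_le (B := δ / (n + 1)) (fun θ hθ => ?_) ?_⟩
  · have := le_csSup hb (Set.mem_image_of_mem (F.llh x) hθ)
    linarith
  · rw [mul_div_assoc', div_le_iff₀ (by positivity)]
    nlinarith

/-- A mean that exceeds both `x` and the index is rejected by some parameter to its left. -/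
lemma exists_of_klIndex_lt {n : ℕ} {δ : ℝ} (hη : η ∈ F.Θ) (hδ : 0 < δ) (hx : x < F.mean η)
    (h : F.klIndex n x δ < F.mean η) :
    ∃ τ ∈ F.Θ, τ < η ∧ δ < n * (F.llh x τ - F.llh x η) := by
  by_contra! hcon
  have hle : (n : EReal) * F.div x η ≤ (δ : EReal) := by
    rcases n.eq_zero_or_pos with rfl | hn
    · rw [Nat.cast_zero, zero_mul]
      exact_mod_cast hδ.le
    have hn' : (0 : ℝ) < n := by exact_mod_cast hn
    refine F.natCast_mul_div_le (B := δ / n) (fun τ hτ => ?_) (mul_div_cancel₀ _ hn'.ne').le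
    rw [le_div_iff₀ hn', mul_comm]
    rcases lt_or_ge τ η with h' | h'
    · exact hcon τ hτ h'
    · have := F.llh_le (x := x) hη hτ
      have : F.llh x τ - F.llh x η ≤ 0 := by nlinarith
      nlinarith
  exact not_le.2 h (le_sSup ⟨η, hη, rfl, hle⟩)

/-- An index above `ḃ(η)`, while `x ≤ ḃ(ζ)` for some `ζ < η`, bounds the number of
observations. -/
lemma mul_kl_le_of_lt_klIndex {n : ℕ} {δ : ℝ} (hζ : ζ ∈ F.Θ) (hη : η ∈ F.Θ) (hζη : ζ ≤ η)
    (hx : x ≤ F.mean ζ) (h : (F.mean η : EReal) < F.klIndex n x δ) :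
    n * F.kl ζ η ≤ δ := by
  obtain ⟨_, ⟨τ, hτ, rfl, hle⟩, hlt⟩ := lt_sSup_iff.1 h
  have hητ := F.lt_of_mean_lt hη hτ (EReal.coe_lt_coe_iff.1 hlt)
  refine le_trans ?_ (F.natCast_mul_llh_le hle hζ)
  refine mul_le_mul_of_nonneg_left ?_ (by positivity)
  -- The divergence of the admissible `τ` is tested at `ζ`; since `x ≤ F.mean ζ` and `ζ ≤ τ`, the
  -- log-likelihood ratio is at least `kl ζ τ`.
  refine (F.kl_mono_right hζ hη hτ hζη hητ.le).trans ?_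
  unfold kl llh
  nlinarith

/-- A log-likelihood that is unbounded on `Θ`, for `x` at least one of the means, increases to
infinity. -/
lemma tendsto_llh (hη : η ∈ F.Θ) (hx : F.mean η ≤ x) (hb : ¬ BddAbove (F.llh x '' F.Θ)) :
    Tendsto (fun τ : F.Θ => F.llh x τ) atTop atTop := by
  -- Otherwise the slope is nonnegative at `η` and negative at `τ`, and the tangent at `τ` gives an
  -- upper bound for the concave log-likelihood.
  have hmean : ∀ τ ∈ F.Θ, F.mean τ ≤ x := by
    intro τ hτ
    by_contra! h
    refine hb ⟨F.llh x τ + (η - τ) * (x - F.mean τ), ?_⟩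
    rintro _ ⟨σ, hσ, rfl⟩
    have hητ := F.lt_of_mean_lt hη hτ (hx.trans_lt h)
    rcases le_total η σ with h' | h'
    · refine (F.llh_le hτ hσ).trans ?_
      nlinarith
    · have h1 := F.llh_le (x := x) hη hσ
      have h2 := F.llh_le (x := x) hτ hη
      nlinarith
  have hmono : Monotone fun τ : F.Θ => F.llh x τ := by
    rintro ⟨σ, hσ⟩ ⟨τ, hτ⟩ h
    have h1 := F.llh_le (x := x) hτ hσ
    have h2 := hmean τ hτ
    have h3 : σ ≤ τ := h
    simp only
    nlinarith
  refine tendsto_atTop_atTop_of_monotone hmono fun M => ?_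
  by_contra! h
  refine hb ⟨M, ?_⟩
  rintro _ ⟨σ, hσ, rfl⟩
  exact (h ⟨σ, hσ⟩).le

end ExpFamily

/-! ### Moment generating functions and Chernoff bounds. -/

namespace ExpFamily

variable (F : ExpFamily) {θ η ζ x : ℝ}

lemma integrable_exp_dist (hθ : θ ∈ F.Θ) (hη : η ∈ F.Θ) :
    Integrable (fun x => Real.exp ((η - θ) * x)) (F.dist θ) := by
  rw [F.dist_eq_tilted hθ, integrable_tilted_iff (F.integrable_exp hθ)]
  refine (F.integrable_exp hη).congr (Eventually.of_forall fun x => ?_)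
  simp only [smul_eq_mul, ← Real.exp_add]
  congr 1
  ring

lemma mgf_dist (hθ : θ ∈ F.Θ) (hη : η ∈ F.Θ) :
    mgf id (F.dist θ) (η - θ) = Real.exp (F.b η - F.b θ) := by
  simp only [mgf, id]
  rw [F.dist_eq_tilted hθ, integral_exp_tilted, F.integral_exp hθ, Real.exp_sub,
    ← F.integral_exp hη]
  congr 2
  funext x
  simp only [Pi.add_apply]
  congr 1
  ring

end ExpFamily

/-- The mean of the first `n` rewards of arm `a`. -/
def armMean {K : ℕ} {Ω : Type*} (Y : Fin K → ℕ → Ω → ℝ) (a : Fin K) (n : ℕ) (ω : Ω) : ℝ :=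
  (∑ k ∈ Finset.range n, Y a k ω) / (n : ℝ)

namespace IsBandit

variable {F : ExpFamily} {K : ℕ} {θ : Fin K → ℝ} {Ω : Type*} [MeasurableSpace Ω]
  {P : Measure Ω} {Y : Fin K → ℕ → Ω → ℝ} {η x : ℝ} {a : Fin K}

lemma iIndepFun_arm (h : IsBandit F θ P Y) (a : Fin K) : iIndepFun (Y a) P :=
  h.indep.precomp (g := fun s => (a, s)) fun _ _ hs => (Prod.mk.inj hs).2

lemma measurable_armMean (h : IsBandit F θ P Y) (a : Fin K) (n : ℕ) :
    Measurable (armMean Y a n) :=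
  (Finset.measurable_sum _ fun k _ => h.measurable a k).div_const _

lemma integrable_exp (h : IsBandit F θ P Y) (hθ : θ a ∈ F.Θ) (hη : η ∈ F.Θ) (s : ℕ) :
    Integrable (fun ω => Real.exp ((η - θ a) * Y a s ω)) P := by
  have := F.integrable_exp_dist hθ hη
  rw [← h.law a s] at this
  exact this.comp_measurable (h.measurable a s)

lemma mgf_eq (h : IsBandit F θ P Y) (hθ : θ a ∈ F.Θ) (hη : η ∈ F.Θ) (s : ℕ) :
    mgf (Y a s) P (η - θ a) = Real.exp (F.b η - F.b (θ a)) := by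
  have := F.isProbability _ hθ
  have hne : NeZero (P.map (Y a s)) := by
    rw [h.law a s]
    exact ⟨IsProbabilityMeasure.ne_zero (F.ξ.withDensity _)⟩
  rw [← mgf_id_map (h.measurable a s).aemeasurable, h.law, F.mgf_dist hθ hη]

lemma integrable_exp_sum [IsProbabilityMeasure P] (h : IsBandit F θ P Y) (hθ : θ a ∈ F.Θ)
    (hη : η ∈ F.Θ) (n : ℕ) :
    Integrable (fun ω => Real.exp ((η - θ a) * (∑ k ∈ Finset.range n, Y a k) ω)) P :=
  (h.iIndepFun_arm a).integrable_exp_mul_sum (h.measurable a)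
    fun s _ => h.integrable_exp hθ hη s

lemma mgf_sum (h : IsBandit F θ P Y) (hθ : θ a ∈ F.Θ) (hη : η ∈ F.Θ) (n : ℕ) :
    mgf (∑ k ∈ Finset.range n, Y a k) P (η - θ a) =
      Real.exp (n * (F.b η - F.b (θ a))) := by
  rw [(h.iIndepFun_arm a).mgf_sum (h.measurable a),
    Finset.prod_congr rfl fun s _ => h.mgf_eq hθ hη s, Finset.prod_const, Finset.card_range,
    ← Real.exp_nat_mul]

/-- The Chernoff bound for the lower tail of the mean of `n` rewards. -/
lemma measure_armMean_le [IsProbabilityMeasure P] (h : IsBandit F θ P Y) (hθ : θ a ∈ F.Θ)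
    (hη : η ∈ F.Θ) (hle : η ≤ θ a) {n : ℕ} (hn : 1 ≤ n) (x : ℝ) :
    P.real {ω | armMean Y a n ω ≤ x} ≤ Real.exp (-(n * (F.llh x η - F.llh x (θ a)))) := by
  have hn' : (0 : ℝ) < n := by exact_mod_cast hn
  have hset : {ω | armMean Y a n ω ≤ x} =
      {ω | (∑ k ∈ Finset.range n, Y a k) ω ≤ x * n} := by
    ext ω
    simp [armMean, div_le_iff₀ hn']
  rw [hset]
  refine (measure_le_le_exp_mul_mgf (x * n) (sub_nonpos.2 hle)
    (h.integrable_exp_sum hθ hη n)).trans_eq ?_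
  rw [h.mgf_sum hθ hη, ← Real.exp_add]
  congr 1
  unfold ExpFamily.llh
  ring

/-- The Chernoff bound for the upper tail of the mean of `n` rewards. -/
lemma measure_le_armMean [IsProbabilityMeasure P] (h : IsBandit F θ P Y) (hθ : θ a ∈ F.Θ)
    (hη : η ∈ F.Θ) (hle : θ a ≤ η) {n : ℕ} (hn : 1 ≤ n) (x : ℝ) :
    P.real {ω | x ≤ armMean Y a n ω} ≤ Real.exp (-(n * (F.llh x η - F.llh x (θ a)))) := by
  have hn' : (0 : ℝ) < n := by exact_mod_cast hn
  have hset : {ω | x ≤ armMean Y a n ω} =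
      {ω | x * n ≤ (∑ k ∈ Finset.range n, Y a k) ω} := by
    ext ω
    simp [armMean, le_div_iff₀ hn']
  rw [hset]
  refine (measure_ge_le_exp_mul_mgf (x * n) (sub_nonneg.2 hle)
    (h.integrable_exp_sum hθ hη n)).trans_eq ?_
  rw [h.mgf_sum hθ hη, ← Real.exp_add]
  congr 1
  unfold ExpFamily.llh
  ring

/-- Almost surely, if the empirical mean is at least one of the means of the family, then its
log-likelihood is bounded on `Θ`: the likelihood ratios have expectation `1`, so by Fatou's lemma
they do not tend to infinity. -/
lemma ae_bddAbove [IsProbabilityMeasure P] (h : IsBandit F θ P Y) (hθ : θ a ∈ F.Θ)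
    (hη : η ∈ F.Θ) {n : ℕ} (hn : 1 ≤ n) :
    ∀ᵐ ω ∂P, F.mean η ≤ armMean Y a n ω → BddAbove (F.llh (armMean Y a n ω) '' F.Θ) := by
  have hn' : (0 : ℝ) < n := by exact_mod_cast hn
  have := F.ordConnected_Θ
  have : Nonempty F.Θ := ⟨⟨η, hη⟩⟩
  obtain ⟨u, hu⟩ := exists_seq_tendsto (atTop : Filter F.Θ)
  -- `L τ` is the likelihood ratio of the first `n` rewards, `τ` against `θ a`; Fatou's lemma is
  -- applied along `u`, which runs to the right end of `Θ`.
  let L : F.Θ → Ω → ENNReal := fun τ ω => ENNReal.ofReal (Real.exp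
    (n * (F.llh (armMean Y a n ω) τ - F.llh (armMean Y a n ω) (θ a))))
  have hL : ∀ τ ω, L τ ω = ENNReal.ofReal (Real.exp (-(n * (F.b τ - F.b (θ a))))) *
      ENNReal.ofReal (Real.exp ((τ - θ a) * (∑ k ∈ Finset.range n, Y a k) ω)) := by
    intro τ ω
    rw [← ENNReal.ofReal_mul (Real.exp_pos _).le, ← Real.exp_add]
    simp only [L]
    congr 2
    have : (∑ k ∈ Finset.range n, Y a k) ω = n * armMean Y a n ω := by
      simp [armMean, mul_div_cancel₀ _ hn'.ne']
    rw [this]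
    unfold ExpFamily.llh
    ring
  have hmeas : ∀ τ, Measurable (L τ) := by
    intro τ
    have := h.measurable_armMean a n
    unfold L ExpFamily.llh
    fun_prop
  have hint : ∀ τ, ∫⁻ ω, L τ ω ∂P = 1 := by
    intro τ
    simp_rw [hL]
    rw [lintegral_const_mul' _ _ ENNReal.ofReal_ne_top,
      ← ofReal_integral_eq_lintegral_ofReal (h.integrable_exp_sum hθ τ.2 n)
        (Eventually.of_forall fun ω => (Real.exp_pos _).le)]
    have := h.mgf_sum hθ τ.2 n
    unfold mgf at this
    rw [this, ← ENNReal.ofReal_mul (Real.exp_pos _).le, ← Real.exp_add]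
    simp
  have hfatou : ∫⁻ ω, liminf (fun i => L (u i) ω) atTop ∂P ≠ ⊤ := by
    refine ((lintegral_liminf_le fun i => hmeas (u i)).trans_lt ?_).ne
    simp [hint]
  filter_upwards [ae_lt_top (Measurable.liminf fun i => hmeas (u i)) hfatou] with ω hω hx
  by_contra hb
  refine hω.ne (Tendsto.liminf_eq ?_)
  refine ENNReal.tendsto_ofReal_atTop.comp (Real.tendsto_exp_atTop.comp ?_)
  exact (tendsto_atTop_add_const_right _ _ ((F.tendsto_llh hη hx hb).comp hu)).const_mul_atTop hn'

end IsBandit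

/-! ### Probability that an index underestimates. -/

/-- If the distribution function of `X` is at most `C` on a set of reals that is bounded above,
then `X` lies in this set with probability at most `C`. -/
lemma measureReal_preimage_le_of_bddAbove {Ω : Type*} [MeasurableSpace Ω] {P : Measure Ω}
    [IsFiniteMeasure P] {X : Ω → ℝ} {B : Set ℝ} {C : ℝ} (hC : 0 ≤ C) (hbdd : BddAbove B)
    (h : ∀ x ∈ B, P.real {ω | X ω ≤ x} ≤ C) : P.real (X ⁻¹' B) ≤ C := by
  rcases B.eq_empty_or_nonempty with rfl | hne
  · simpa using hC
  -- If the supremum is not attained, `X` in `B` lies strictly below it, and the events `X ≤ u k`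
  -- along `u k ↑ sSup B` exhaust this case.
  by_cases hmax : sSup B ∈ B
  · exact (measureReal_mono (s₂ := {ω | X ω ≤ sSup B}) fun ω hω => le_csSup hbdd hω).trans (h _ hmax)
  obtain ⟨u, hu, hlim, hmem⟩ := exists_seq_tendsto_sSup hne hbdd
  have hsub : X ⁻¹' B ⊆ ⋃ k, {ω | X ω ≤ u k} := by
    intro ω hω
    have hlt : X ω < sSup B := (le_csSup hbdd hω).lt_of_ne fun he => hmax (he ▸ hω)
    obtain ⟨k, hk⟩ := (hlim.eventually (lt_mem_nhds hlt)).exists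
    exact Set.mem_iUnion.2 ⟨k, hk.le⟩
  have hmono : Monotone fun k => {ω | X ω ≤ u k} := fun i j hij ω hω => le_trans hω (hu hij)
  refine (measureReal_mono hsub).trans ?_
  refine le_of_tendsto ((ENNReal.tendsto_toReal (measure_ne_top _ _)).comp
    (tendsto_measure_iUnion_atTop hmono)) (Eventually.of_forall fun k => h _ (hmem k))

namespace IsBandit

variable {F : ExpFamily} {K : ℕ} {θ : Fin K → ℝ} {Ω : Type*} [MeasurableSpace Ω]
  {P : Measure Ω} {Y : Fin K → ℕ → Ω → ℝ} {η x : ℝ} {a : Fin K}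

/-- The probability that the index with `n` observations underestimates a mean below that of the
arm. -/
lemma measure_klIndex_lt [IsProbabilityMeasure P] (h : IsBandit F θ P Y) (hθ : θ a ∈ F.Θ)
    (hη : η ∈ F.Θ) (hlt : η < θ a) {n : ℕ} (hn : 1 ≤ n) {δ : ℝ} (hδ : 0 < δ) :
    P.real {ω | F.klIndex n (armMean Y a n ω) δ < F.mean η} ≤
      Real.exp (-δ) * Real.exp (-(n * F.kl η (θ a))) := by
  have hn' : (0 : ℝ) < n := by exact_mod_cast hn
  set B : Set ℝ := {x | x < F.mean η ∧ ∃ τ ∈ F.Θ, τ < η ∧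
    δ < n * (F.llh x τ - F.llh x η)} with hBdef
  -- An empirical mean at or above `F.mean η` leads to underestimation only if its log-likelihood is
  -- unbounded, a null event.
  have hsub : ∀ᵐ ω ∂P, ω ∈ {ω | F.klIndex n (armMean Y a n ω) δ < F.mean η} →
      ω ∈ armMean Y a n ⁻¹' B := by
    filter_upwards [h.ae_bddAbove hθ hη hn] with ω hω hidx
    have hx : armMean Y a n ω < F.mean η := by
      by_contra! hx
      exact absurd (F.mean_le_klIndex hη hδ hx (hω hx)) (not_le.2 hidx)
    exact ⟨hx, F.exists_of_klIndex_lt hη hδ hx hidx⟩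
  have hmono : P.real {ω | F.klIndex n (armMean Y a n ω) δ < F.mean η} ≤
      P.real (armMean Y a n ⁻¹' B) :=
    ENNReal.toReal_mono (measure_ne_top _ _) (measure_mono_ae hsub)
  refine hmono.trans ?_
  refine measureReal_preimage_le_of_bddAbove (by positivity) ?_ ?_
  · exact ⟨F.mean η, fun x hx => hx.1.le⟩
  · rintro x ⟨hx, τ, hτ, hτη, hlt'⟩
    -- The tilt `τ` depends on `x`, but the final bound does not: passing from `τ` to `η` gains `δ`,
    -- and from `η` to `θ a` at least `n * kl η (θ a)`.
    refine (h.measure_armMean_le hθ hτ (hτη.trans hlt).le hn x).trans ?_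
    rw [← Real.exp_add]
    refine Real.exp_le_exp.2 ?_
    have h1 : F.kl η (θ a) ≤ F.llh x η - F.llh x (θ a) := by
      unfold ExpFamily.kl ExpFamily.llh
      nlinarith
    have h2 := mul_le_mul_of_nonneg_left h1 hn'.le
    linarith

end IsBandit

/-! ### Counting the draws of an arm. -/

section Counting

variable {K : ℕ} {Ω : Type*} {A : ℕ → Ω → Fin K} {a : Fin K}

lemma pulls_succ (t : ℕ) (ω : Ω) :
    pulls A a (t + 1) ω = pulls A a t ω + if A (t + 1) ω = a then 1 else 0 := by
  unfold pulls
  rw [← Finset.insert_Icc_right_eq_Icc_add_one (by omega), Finset.filter_insert]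
  split_ifs
  · rw [Finset.card_insert_of_notMem (by simp)]
  · rfl

lemma pulls_le (t : ℕ) (ω : Ω) : pulls A a t ω ≤ t :=
  (Finset.card_filter_le _ _).trans (by simp)

lemma pulls_mono (ω : Ω) : Monotone fun t => pulls A a t ω :=
  fun _ _ h => Finset.card_le_card
    (Finset.filter_subset_filter _ (Finset.Icc_subset_Icc_right h))

open Classical in
/-- If each draw of `a` after round `t₀` happens at a round in `E`, or at a number of previous
draws with property `p`, then the number of draws is at most `t₀` plus the number of such rounds
plus the number of such counts: each count is used once. -/
lemma pulls_le_add_card {t₀ T : ℕ} {ω : Ω} {E p : ℕ → Prop}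
    (h : ∀ t, t₀ ≤ t → t < T → A (t + 1) ω = a → E t ∨ p (pulls A a t ω)) :
    pulls A a T ω ≤ t₀ + ((Finset.Ico t₀ T).filter E).card +
      ((Finset.range (pulls A a T ω)).filter p).card := by
  induction T with
  | zero => simp [pulls]
  | succ T ih =>
    rcases le_or_gt (T + 1) t₀ with hT | hT
    · have := pulls_le (A := A) (a := a) (T + 1) ω
      omega
    have hT' : t₀ ≤ T := by omega
    have ih := ih fun t h1 h2 => h t h1 (by omega)
    have hE : ((Finset.Ico t₀ (T + 1)).filter E).card =
        ((Finset.Ico t₀ T).filter E).card + if E T then 1 else 0 := by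
      rw [← Finset.insert_Ico_right_eq_Ico_add_one hT', Finset.filter_insert]
      split_ifs
      · rw [Finset.card_insert_of_notMem (by simp)]
      · rfl
    rw [pulls_succ, hE]
    by_cases hA : A (T + 1) ω = a
    · have hp : ((Finset.range (pulls A a T ω + 1)).filter p).card =
          ((Finset.range (pulls A a T ω)).filter p).card +
            if p (pulls A a T ω) then 1 else 0 := by
        rw [Finset.range_add_one, Finset.filter_insert]
        split_ifs
        · rw [Finset.card_insert_of_notMem (by simp)]
        · rfl
      rw [if_pos hA, hp]
      rcases h T hT' (by omega) hA with h' | h'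
      · rw [if_pos h']
        omega
      · rw [if_pos h']
        omega
    · rw [if_neg hA, add_zero]
      omega

/-- Leaving out the count `0` makes the bound `S` rather than `S + 1`. -/
lemma card_filter_pos_le {N : ℕ} {S : ℝ} (hS : 0 ≤ S) :
    (((Finset.range N).filter fun n : ℕ => 1 ≤ n ∧ (n : ℝ) ≤ S).card : ℝ) ≤ S := by
  refine le_trans ?_ (Nat.floor_le hS)
  have : (Finset.range N).filter (fun n : ℕ => 1 ≤ n ∧ (n : ℝ) ≤ S) ⊆ Finset.Icc 1 ⌊S⌋₊ := by
    intro n hn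
    rw [Finset.mem_filter] at hn
    exact Finset.mem_Icc.2 ⟨hn.2.1, Nat.le_floor hn.2.2⟩
  have := Finset.card_le_card this
  simp only [Nat.card_Icc, add_tsub_cancel_right] at this
  exact_mod_cast this

variable [MeasurableSpace Ω] {P : Measure Ω} [IsProbabilityMeasure P]

/-- A draw of `a` after round `t₀` happens on a rare event, or at a count at most `S`, or at a
count at which a rare event happens. -/
lemma integral_pulls_le {t₀ T : ℕ} {S : ℝ} (hS : 0 ≤ S) {E G : ℕ → Set Ω}
    (hE : ∀ t, MeasurableSet (E t)) (hG : ∀ n, MeasurableSet (G n))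
    (h : ∀ ω t, t₀ ≤ t → t < T → A (t + 1) ω = a →
      ω ∈ E t ∨ (1 ≤ pulls A a t ω ∧ ((pulls A a t ω : ℝ) ≤ S ∨ ω ∈ G (pulls A a t ω)))) :
    ∫ ω, (pulls A a T ω : ℝ) ∂P ≤
      t₀ + ∑ t ∈ Finset.Ico t₀ T, P.real (E t) + S + ∑ n ∈ Finset.Icc 1 T, P.real (G n) := by
  classical
  have hi : ∀ {s : Set Ω}, MeasurableSet s → Integrable (s.indicator (1 : Ω → ℝ)) P :=
    fun hs => (integrable_const (1 : ℝ)).indicator hs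
  have hiE : Integrable (fun ω => ∑ t ∈ Finset.Ico t₀ T, (E t).indicator (1 : Ω → ℝ) ω) P :=
    integrable_finsetSum _ fun t _ => hi (hE t)
  have hiG : Integrable (fun ω => ∑ n ∈ Finset.Icc 1 T, (G n).indicator (1 : Ω → ℝ) ω) P :=
    integrable_finsetSum _ fun n _ => hi (hG n)
  have hpath : ∀ ω, (pulls A a T ω : ℝ) ≤
      t₀ + ∑ t ∈ Finset.Ico t₀ T, (E t).indicator (1 : Ω → ℝ) ω + S +
        ∑ n ∈ Finset.Icc 1 T, (G n).indicator (1 : Ω → ℝ) ω := by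
    intro ω
    have h1 := pulls_le_add_card (E := fun t => ω ∈ E t)
      (p := fun n : ℕ => 1 ≤ n ∧ ((n : ℝ) ≤ S ∨ ω ∈ G n)) (h ω)
    have h2 : (Finset.range (pulls A a T ω)).filter (fun n : ℕ => 1 ≤ n ∧ ((n : ℝ) ≤ S ∨ ω ∈ G n)) ⊆
        (Finset.range (pulls A a T ω)).filter (fun n : ℕ => 1 ≤ n ∧ (n : ℝ) ≤ S) ∪
          (Finset.Icc 1 T).filter (fun n : ℕ => ω ∈ G n) := by
      intro n hn
      simp only [Finset.mem_filter, Finset.mem_union, Finset.mem_range, Finset.mem_Icc] at hn ⊢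
      have := pulls_le (A := A) (a := a) T ω
      rcases hn.2.2 with h' | h'
      · exact Or.inl ⟨hn.1, hn.2.1, h'⟩
      · exact Or.inr ⟨⟨hn.2.1, by omega⟩, h'⟩
    have h3 := (Finset.card_le_card h2).trans (Finset.card_union_le _ _)
    have h4 := card_filter_pos_le (N := pulls A a T ω) hS
    have h5 : ∀ (s : Finset ℕ) (U : ℕ → Set Ω), ∑ t ∈ s, (U t).indicator (1 : Ω → ℝ) ω =
        ((s.filter fun t => ω ∈ U t).card : ℝ) := by
      intro s U
      simp [Set.indicator_apply]
    rw [h5, h5]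
    have h6 : (pulls A a T ω : ℝ) ≤ t₀ + ((Finset.Ico t₀ T).filter fun t => ω ∈ E t).card +
      (((Finset.range (pulls A a T ω)).filter (fun n : ℕ => 1 ≤ n ∧ (n : ℝ) ≤ S)).card +
        ((Finset.Icc 1 T).filter (fun n : ℕ => ω ∈ G n)).card) := by
      exact_mod_cast h1.trans (Nat.add_le_add_left (le_of_eq_of_le (by congr!) h3) _)
    linarith
  refine (integral_mono_of_nonneg (Eventually.of_forall fun ω => Nat.cast_nonneg _)
    ((((integrable_const _).add hiE).add (integrable_const _)).add hiG)
    (Eventually.of_forall hpath)).trans_eq ?_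
  rw [integral_add' (((integrable_const _).add hiE).add (integrable_const _)) hiG,
    integral_add' ((integrable_const _).add hiE) (integrable_const _),
    integral_add' (integrable_const _) hiE,
    integral_finsetSum _ fun t _ => hi (hE t), integral_finsetSum _ fun n _ => hi (hG n)]
  simp [integral_indicator_one, hE, hG]

end Counting

/-! ### Expected draws of a suboptimal arm under an index policy. -/

section Regret

variable {F : ExpFamily} {K : ℕ} {θ : Fin K → ℝ} {Ω : Type*} [MeasurableSpace Ω]
  {P : Measure Ω} [IsProbabilityMeasure P] {Y : Fin K → ℕ → Ω → ℝ} {a aStar : Fin K}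

lemma summable_mul_exp_neg {κ : ℝ} (hκ : 0 < κ) :
    Summable fun n : ℕ => (n : ℝ) * Real.exp (-(n * κ)) := by
  refine (Real.summable_pow_mul_exp_neg_nat_mul 1 hκ).congr fun n => ?_
  rw [pow_one]
  congr 2
  ring

lemma summable_exp_neg {κ : ℝ} (hκ : 0 < κ) : Summable fun n : ℕ => Real.exp (-(n * κ)) := by
  refine (Real.summable_pow_mul_exp_neg_nat_mul 0 hκ).congr fun n => ?_
  rw [pow_zero, one_mul]
  congr 1
  ring

/-- The probability that one of the indices with exploration rate `log (v / n)`, `n ≤ t`,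
underestimates a mean below that of the arm. -/
lemma IsBandit.measure_iUnion_klIndex_lt (h : IsBandit F θ P Y) {η v : ℝ} (hθ : θ a ∈ F.Θ)
    (hη : η ∈ F.Θ) (hlt : η < θ a) (hκ : 0 < F.kl η (θ a)) {t : ℕ} (hv : (t : ℝ) < v) :
    P.real (⋃ n ∈ Finset.Icc 1 t,
      {ω | F.klIndex n (armMean Y a n ω) (Real.log (v / n)) < F.mean η}) ≤
      (∑' n : ℕ, (n : ℝ) * Real.exp (-(n * F.kl η (θ a)))) * v⁻¹ := by
  have hv0 : 0 < v := (Nat.cast_nonneg t).trans_lt hv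
  refine (measureReal_biUnion_finset_le _ _).trans ?_
  calc _ ≤ ∑ n ∈ Finset.Icc 1 t, (n : ℝ) * Real.exp (-(n * F.kl η (θ a))) * v⁻¹ := by
        refine Finset.sum_le_sum fun n hn => ?_
        obtain ⟨hn1, hnt⟩ := Finset.mem_Icc.1 hn
        have hn0 : (0 : ℝ) < n := by exact_mod_cast hn1
        have hnv : (n : ℝ) < v := lt_of_le_of_lt (by exact_mod_cast hnt) hv
        refine (h.measure_klIndex_lt hθ hη hlt hn1
          (Real.log_pos ((one_lt_div hn0).2 hnv))).trans_eq ?_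
        rw [Real.exp_neg, Real.exp_log (by positivity)]
        field_simp
    _ ≤ _ := by
        rw [← Finset.sum_mul]
        refine mul_le_mul_of_nonneg_right ?_ (by positivity)
        exact (summable_mul_exp_neg hκ).sum_le_tsum _ fun n _ => by positivity

/-- The bound on the expected number of draws of a suboptimal arm under an index policy with
exploration rate `log (v t / N_a(t))`. -/
lemma IsBandit.integral_pulls_le_of_followsIndex (h : IsBandit F θ P Y) (hθ : ∀ i, θ i ∈ F.Θ)
    (hsub : F.mean (θ a) < F.mean (θ aStar)) {ζ η η' : ℝ} (hζ : ζ ∈ F.Θ) (hη : η ∈ F.Θ)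
    (hη' : η' ∈ F.Θ) (h1 : θ a < ζ) (h2 : ζ < η) (h3 : η < η') (h4 : η' < θ aStar)
    {t₀ T : ℕ} (hKt₀ : K ≤ t₀) {v : ℕ → ℝ} {V : ℝ} (hV : 1 ≤ V)
    (hv : ∀ t, t₀ ≤ t → t < T → (t : ℝ) < v t ∧ v t ≤ V) {A : ℕ → Ω → Fin K}
    (hA : FollowsIndex (fun i t ω => F.klIndex (pulls A i t ω) (empMean Y A i t ω)
      (Real.log (v t / (pulls A i t ω : ℝ)))) A T) :
    ∫ ω, (pulls A a T ω : ℝ) ∂P ≤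
      t₀ + (∑' n : ℕ, (n : ℝ) * Real.exp (-(n * F.kl η' (θ aStar)))) *
        ∑ t ∈ Finset.Ico t₀ T, (v t)⁻¹ + Real.log V / F.kl ζ η +
        ∑' n : ℕ, Real.exp (-(n * F.kl ζ (θ a))) := by
  have hpos : ∀ {α β : ℝ}, α ∈ F.Θ → β ∈ F.Θ → α ≠ β → 0 < F.kl α β :=
    fun hα hβ hne => F.kl_pos (hθ a) (hθ aStar) hsub hα hβ hne
  have hκ := hpos hη' (hθ aStar) h4.ne
  have hκ₁ := hpos hζ hη h2.ne
  have hκ₂ := hpos hζ (hθ a) h1.ne'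
  have hmean := F.mean_lt (hθ a) (hθ aStar) hsub hη hη' h3
  -- The count of the best arm is random, so `E t` takes the union over all its possible values. Its
  -- measurable hull is used below, which has the same measure.
  set E : ℕ → Set Ω := fun t => ⋃ n ∈ Finset.Icc 1 t,
    {ω | F.klIndex n (armMean Y aStar n ω) (Real.log (v t / n)) < F.mean η'} with hEdef
  set G : ℕ → Set Ω := fun n => {ω | F.mean ζ ≤ armMean Y a n ω} with hGdef
  have hcount : ∀ ω t, t₀ ≤ t → t < T → A (t + 1) ω = a →
      ω ∈ toMeasurable P (E t) ∨ (1 ≤ pulls A a t ω ∧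
        ((pulls A a t ω : ℝ) ≤ Real.log V / F.kl ζ η ∨ ω ∈ G (pulls A a t ω))) := by
    intro ω t ht htT hAt
    have hpulls : ∀ i, 1 ≤ pulls A i t ω := fun i =>
      (hA.init (by omega) i ω).ge.trans (pulls_mono ω (by omega))
    obtain ⟨hvt, hvV⟩ := hv t ht htT
    by_cases hE : ω ∈ E t
    · exact Or.inl (subset_toMeasurable _ _ hE)
    refine Or.inr ⟨hpulls a, ?_⟩
    rcases le_or_gt (F.mean ζ) (armMean Y a (pulls A a t ω) ω) with hx | hx
    · exact Or.inr hx
    left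
    have hstar : (F.mean η' : EReal) ≤ F.klIndex (pulls A aStar t ω)
        (armMean Y aStar (pulls A aStar t ω) ω)
        (Real.log (v t / (pulls A aStar t ω : ℝ))) := by
      by_contra! hcon
      exact hE (Set.mem_biUnion (Finset.mem_coe.2
        (Finset.mem_Icc.2 ⟨hpulls aStar, pulls_le t ω⟩)) hcon)
    have hgreedy := hA.greedy t (by omega) htT ω aStar
    rw [hAt] at hgreedy
    -- The gap `η < η'` turns a weak lower bound on the supremum into a strict one, so that an
    -- admissible mean above `F.mean η` exists.
    have hlt := (EReal.coe_lt_coe_iff.2 hmean).trans_le (hstar.trans hgreedy)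
    have hle := F.mul_kl_le_of_lt_klIndex hζ hη h2.le hx.le hlt
    rw [le_div_iff₀ hκ₁]
    refine hle.trans (Real.log_le_log ?_ ?_)
    · have : (0 : ℝ) < pulls A a t ω := by exact_mod_cast hpulls a
      have : 0 < v t := (Nat.cast_nonneg t).trans_lt hvt
      positivity
    · refine (div_le_self ((Nat.cast_nonneg t).trans hvt.le) ?_).trans hvV
      exact_mod_cast hpulls a
  refine (integral_pulls_le (div_nonneg (Real.log_nonneg hV) hκ₁.le)
    (fun t => measurableSet_toMeasurable P (E t))
    (fun n => measurableSet_le measurable_const (h.measurable_armMean a n)) hcount).trans ?_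
  have hsumE : ∑ t ∈ Finset.Ico t₀ T, P.real (toMeasurable P (E t)) ≤
      (∑' n : ℕ, (n : ℝ) * Real.exp (-(n * F.kl η' (θ aStar)))) *
        ∑ t ∈ Finset.Ico t₀ T, (v t)⁻¹ := by
    rw [Finset.mul_sum]
    refine Finset.sum_le_sum fun t ht => ?_
    obtain ⟨ht1, ht2⟩ := Finset.mem_Ico.1 ht
    rw [measureReal_def, measure_toMeasurable]
    exact h.measure_iUnion_klIndex_lt (hθ aStar) hη' h4 hκ (hv t ht1 ht2).1
  have hsumG : ∑ n ∈ Finset.Icc 1 T, P.real (G n) ≤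
      ∑' n : ℕ, Real.exp (-(n * F.kl ζ (θ a))) := by
    refine (Finset.sum_le_sum fun n hn => ?_).trans
      ((summable_exp_neg hκ₂).sum_le_tsum (Finset.Icc 1 T) fun n _ => by positivity)
    refine (h.measure_le_armMean (hθ a) hζ h1.le (Finset.mem_Icc.1 hn).1 _).trans_eq ?_
    congr 2
    unfold ExpFamily.kl ExpFamily.llh
    ring
  linarith

end Regret

/-! ### Real estimates and the choice of the intermediate parameters. -/

lemma one_le_log_of_three_le {t : ℕ} (ht : 3 ≤ t) : 1 < Real.log t := by
  rw [Real.lt_log_iff_exp_lt (by positivity)]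
  have : (3 : ℝ) ≤ t := by exact_mod_cast ht
  linarith [Real.exp_one_lt_d9]

/-- The series `∑ 1 / (t log^c t)` converges for `c ≥ 2`. -/
lemma sum_inv_mul_log_rpow_le {c : ℝ} (hc : 2 ≤ c) {t₀ : ℕ} (ht₀ : 3 ≤ t₀) (T : ℕ) :
    ∑ t ∈ Finset.Ico t₀ T, ((t : ℝ) * Real.log t ^ c)⁻¹ ≤ (Real.log 2)⁻¹ := by
  have hlog2 : 0 < Real.log 2 := Real.log_pos (by norm_num)
  -- Telescoping against `-1 / log`, a primitive of `1 / (x log² x)`. The shift to `T - 1` bounds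
  -- each term by the increment that precedes it, and `t₀ ≥ 3` keeps that logarithm at least `log
  -- 2`.
  suffices h : ∀ T, t₀ ≤ T → ∑ t ∈ Finset.Ico t₀ T, ((t : ℝ) * Real.log t ^ c)⁻¹ ≤
      (Real.log 2)⁻¹ - (Real.log ((T : ℝ) - 1))⁻¹ by
    rcases le_or_gt t₀ T with hT | hT
    · refine (h T hT).trans (sub_le_self _ (inv_nonneg.2 (Real.log_nonneg ?_)))
      have : (3 : ℝ) ≤ T := by exact_mod_cast ht₀.trans hT
      linarith
    · rw [Finset.Ico_eq_empty (by omega), Finset.sum_empty]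
      positivity
  intro T hT
  induction T, hT using Nat.le_induction with
  | base =>
    rw [Finset.Ico_self, Finset.sum_empty, sub_nonneg]
    have : (3 : ℝ) ≤ t₀ := by exact_mod_cast ht₀
    exact inv_anti₀ hlog2 (Real.log_le_log (by norm_num) (by linarith))
  | succ T hT ih =>
    rw [← Finset.insert_Ico_right_eq_Ico_add_one hT, Finset.sum_insert (by simp)]
    have hT3 : (3 : ℝ) ≤ T := by exact_mod_cast ht₀.trans hT
    have hl := one_le_log_of_three_le (ht₀.trans hT)
    have hl' : 0 < Real.log ((T : ℝ) - 1) := Real.log_pos (by linarith)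
    have hle : Real.log ((T : ℝ) - 1) ≤ Real.log T := Real.log_le_log (by linarith) (by linarith)
    have hgap : (T : ℝ)⁻¹ ≤ Real.log T - Real.log ((T : ℝ) - 1) := by
      have h := Real.log_le_sub_one_of_pos (x := ((T : ℝ) - 1) / T)
        (div_pos (by linarith) (by linarith))
      rw [Real.log_div (by linarith) (by linarith)] at h
      have : ((T : ℝ) - 1) / T - 1 = -(T : ℝ)⁻¹ := by
        field_simp
        ring
      linarith
    have hpow : Real.log T ^ 2 ≤ Real.log T ^ c := by
      rw [← Real.rpow_natCast]
      exact Real.rpow_le_rpow_of_exponent_le hl.le (by exact_mod_cast hc)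
    have hterm : ((T : ℝ) * Real.log T ^ c)⁻¹ ≤
        (Real.log ((T : ℝ) - 1))⁻¹ - (Real.log T)⁻¹ := by
      calc ((T : ℝ) * Real.log T ^ c)⁻¹ ≤ ((T : ℝ) * Real.log T ^ 2)⁻¹ := by gcongr
        _ = (T : ℝ)⁻¹ / (Real.log T * Real.log T) := by
            rw [mul_inv, sq, div_eq_mul_inv]
        _ ≤ (Real.log T - Real.log ((T : ℝ) - 1)) / (Real.log T * Real.log ((T : ℝ) - 1)) := by
            gcongr
        _ = _ := by
            field_simp
    push_cast
    rw [add_sub_cancel_right]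
    linarith

/-- Used at `x = log T`, to absorb `c * log (log T)` into a multiple of `√(log T)`. -/
lemma log_le_two_mul_sqrt {x : ℝ} (hx : 0 < x) : Real.log x ≤ 2 * Real.sqrt x := by
  have h := Real.log_le_sub_one_of_pos (Real.sqrt_pos.2 hx)
  rw [Real.log_sqrt hx.le] at h
  linarith

namespace ExpFamily

/-- Parameters strictly between `α` and `β` whose divergence is close to `KL(ν_α, ν_β)`. -/
lemma exists_kl_approx (F : ExpFamily) {α β ε : ℝ} (hα : α ∈ F.Θ) (hβ : β ∈ F.Θ)
    (h : F.mean α < F.mean β) (hε : 0 < ε) :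
    ∃ ζ ∈ F.Θ, ∃ η ∈ F.Θ, ∃ η' ∈ F.Θ, α < ζ ∧ ζ < η ∧ η < η' ∧ η' < β ∧
      F.kl α β / (1 + ε) ≤ F.kl ζ η := by
  have hlt := F.lt_of_mean_lt hα hβ h
  have hpos := F.kl_pos hα hβ h hα hβ hlt.ne
  have h1 : ∀ᶠ r in 𝓝[>] (0 : ℝ), F.kl α β / (1 + ε) < F.kl (α + r) (β - r) :=
    ((F.tendsto_kl hα hβ).mono_left nhdsWithin_le_nhds).eventually
      (lt_mem_nhds (div_lt_self hpos (by linarith)))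
  have h2 : Set.Ioo (0 : ℝ) ((β - α) / 2) ∈ 𝓝[>] (0 : ℝ) :=
    Ioo_mem_nhdsGT (by linarith)
  obtain ⟨r, hr1, hr0, hr2⟩ := (h1.and h2).exists
  have hmem : ∀ {x}, α ≤ x → x ≤ β → x ∈ F.Θ := fun hx hx' =>
    F.ordConnected_Θ.out hα hβ ⟨hx, hx'⟩
  refine ⟨α + r, hmem (by linarith) (by linarith), β - r, hmem (by linarith) (by linarith),
    β - r / 2, hmem (by linarith) (by linarith), by linarith, by linarith, by linarith,
    by linarith, hr1.le⟩

end ExpFamily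

/-! ### The finite-horizon bound and its asymptotic consequence. -/

variable (F : ExpFamily) {K : ℕ} (θ : Fin K → ℝ) (a aStar : Fin K)

/-- The bound at each horizon, for both policies. -/
theorem exists_integral_pulls_le (hθ : ∀ i, θ i ∈ F.Θ) {c : ℝ} (hc : 2 ≤ c)
    (hsub : F.mean (θ a) < F.mean (θ aStar)) {ε : ℝ} (hε : 0 < ε) :
    ∃ C : ℝ, ∀ (Ω : Type u) [MeasurableSpace Ω] (P : Measure Ω)
      [IsProbabilityMeasure P] (Y : Fin K → ℕ → Ω → ℝ), IsBandit F θ P Y →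
      ∀ T : ℕ, 2 ≤ T → ∀ A : ℕ → Ω → Fin K,
        (FollowsIndex (klUCBPlusIndex F c Y A) A T ∨
          FollowsIndex (klUCBHPlusIndex F c T Y A) A T) →
        ∫ ω, (pulls A a T ω : ℝ) ∂P ≤
          (1 + ε) / F.kl (θ a) (θ aStar) * Real.log T + C * Real.sqrt (Real.log T) := by
  obtain ⟨ζ, hζ, η, hη, η', hη', h1, h2, h3, h4, hkl⟩ :=
    F.exists_kl_approx (hθ a) (hθ aStar) hsub hε
  have hd := F.kl_pos (hθ a) (hθ aStar) hsub (hθ a) (hθ aStar)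
    (F.lt_of_mean_lt (hθ a) (hθ aStar) hsub).ne
  have hκ := F.kl_pos (hθ a) (hθ aStar) hsub hζ hη h2.ne
  set C₁ := ∑' n : ℕ, (n : ℝ) * Real.exp (-(n * F.kl η' (θ aStar))) with hC₁
  set C₂ := ∑' n : ℕ, Real.exp (-(n * F.kl ζ (θ a))) with hC₂
  have hC₁0 : 0 ≤ C₁ := tsum_nonneg fun n => by positivity
  have hC₂0 : 0 ≤ C₂ := tsum_nonneg fun n => by positivity
  have hlog2 : 0 < Real.log 2 := Real.log_pos (by norm_num)
  -- From `t₀` on, initialisation is over and `log t > 1`, whence `t < t log^c t`: all exploration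
  -- rates are positive.
  set t₀ := max K 3 with ht₀
  -- `B` collects the terms that stay bounded in `T`. The factor `1 + 1 / log 2` covers both
  -- policies: `∑ 1 / v` is at most `1 / log 2` for the anytime rate, and at most `1` for the
  -- horizon rate.
  set B : ℝ := t₀ + C₁ * (1 + (Real.log 2)⁻¹) + C₂ with hB
  have hB0 : t₀ ≤ B := by
    have : 0 ≤ C₁ * (1 + (Real.log 2)⁻¹) := by positivity
    linarith
  have hB0' : 0 ≤ B := (Nat.cast_nonneg t₀).trans hB0
  -- Since `T ≥ 2`, dividing by `√(log 2)` turns the constant `B` into a multiple of `√(log T)`; the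
  -- second summand pays for `c * log (log T)`.
  refine ⟨B / Real.sqrt (Real.log 2) + 2 * c / F.kl ζ η, ?_⟩
  intro Ω _ P _ Y hY T hT A hA
  have hlogT : Real.log 2 ≤ Real.log T := Real.log_le_log (by norm_num) (by exact_mod_cast hT)
  have hlogT0 : 0 < Real.log T := hlog2.trans_le hlogT
  have hBsqrt : B ≤ B / Real.sqrt (Real.log 2) * Real.sqrt (Real.log T) := by
    rw [div_mul_eq_mul_div, le_div_iff₀ (Real.sqrt_pos.2 hlog2)]
    exact mul_le_mul_of_nonneg_left (Real.sqrt_le_sqrt hlogT) hB0'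
  rcases le_or_gt T t₀ with hTt | hTt
  · have hle : ∫ ω, (pulls A a T ω : ℝ) ∂P ≤ t₀ := by
      refine (integral_mono_of_nonneg (Eventually.of_forall fun ω => Nat.cast_nonneg _)
        (integrable_const (t₀ : ℝ)) (Eventually.of_forall fun ω => ?_)).trans_eq (by simp)
      exact Nat.cast_le.2 ((pulls_le T ω).trans hTt)
    have e1 : 0 ≤ (1 + ε) / F.kl (θ a) (θ aStar) * Real.log T := by positivity
    have e2 : 0 ≤ 2 * c / F.kl ζ η * Real.sqrt (Real.log T) := by positivity
    linarith
  have h3t : 3 ≤ t₀ := le_max_right _ _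
  have hcast3 : ∀ {t : ℕ}, t₀ ≤ t → (3 : ℝ) ≤ t := fun ht => by exact_mod_cast h3t.trans ht
  have hpow : ∀ {t : ℕ}, t₀ ≤ t → 1 < Real.log t ^ c := fun ht =>
    Real.one_lt_rpow (one_le_log_of_three_le (h3t.trans ht)) (by linarith)
  have hlt : ∀ {t : ℕ}, t₀ ≤ t → (t : ℝ) < t * Real.log t ^ c := fun ht =>
    lt_mul_of_one_lt_right (by linarith [hcast3 ht]) (hpow ht)
  have hV : 1 ≤ (T : ℝ) * Real.log T ^ c := by
    linarith [hlt hTt.le, hcast3 hTt.le]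
  have hlogV : Real.log ((T : ℝ) * Real.log T ^ c) / F.kl ζ η ≤
      (1 + ε) / F.kl (θ a) (θ aStar) * Real.log T +
        2 * c / F.kl ζ η * Real.sqrt (Real.log T) := by
    rw [Real.log_mul (by linarith [hcast3 hTt.le]) (by linarith [hpow hTt.le]),
      Real.log_rpow hlogT0, add_div]
    refine add_le_add ?_ ?_
    · rw [div_eq_inv_mul]
      refine mul_le_mul_of_nonneg_right ?_ hlogT0.le
      rw [← inv_div]
      exact inv_anti₀ (by positivity) hkl
    · rw [div_mul_eq_mul_div]
      refine div_le_div_of_nonneg_right ?_ hκ.le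
      have := mul_le_mul_of_nonneg_left (log_le_two_mul_sqrt hlogT0) (by linarith : 0 ≤ c)
      linarith
  have key : ∀ v : ℕ → ℝ,
      (∀ t, t₀ ≤ t → t < T → (t : ℝ) < v t ∧ v t ≤ (T : ℝ) * Real.log T ^ c) →
      (∑ t ∈ Finset.Ico t₀ T, (v t)⁻¹ ≤ 1 + (Real.log 2)⁻¹) →
      FollowsIndex (fun i t ω => F.klIndex (pulls A i t ω) (empMean Y A i t ω)
        (Real.log (v t / (pulls A i t ω : ℝ)))) A T →
      ∫ ω, (pulls A a T ω : ℝ) ∂P ≤ (1 + ε) / F.kl (θ a) (θ aStar) * Real.log T +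
        (B / Real.sqrt (Real.log 2) + 2 * c / F.kl ζ η) * Real.sqrt (Real.log T) := by
    intro v hv hsum hfol
    have hmain := hY.integral_pulls_le_of_followsIndex hθ hsub hζ hη hη' h1 h2 h3 h4
      (le_max_left K 3) hV hv hfol
    have := mul_le_mul_of_nonneg_left hsum hC₁0
    linarith
  rcases hA with hA | hA
  · refine key (fun t => (t : ℝ) * Real.log t ^ c) (fun t ht htT => ⟨hlt ht, ?_⟩)
      ((sum_inv_mul_log_rpow_le hc h3t T).trans (by linarith)) hA
    have htT' : (t : ℝ) ≤ T := by exact_mod_cast htT.le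
    have := hcast3 ht
    have := one_le_log_of_three_le (h3t.trans ht)
    gcongr
  · refine key (fun _ => (T : ℝ) * Real.log T ^ c) (fun t ht htT => ⟨?_, le_rfl⟩) ?_ hA
    · exact lt_of_le_of_lt (by exact_mod_cast htT.le) (hlt hTt.le)
    · rw [Finset.sum_const, Nat.card_Ico, nsmul_eq_mul]
      have e1 : ((T - t₀ : ℕ) : ℝ) ≤ (T : ℝ) * Real.log T ^ c :=
        le_trans (by exact_mod_cast Nat.sub_le _ _) (hlt hTt.le).le
      have e2 : ((T - t₀ : ℕ) : ℝ) * ((T : ℝ) * Real.log T ^ c)⁻¹ ≤ 1 := by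
        rw [← div_eq_mul_inv]
        exact div_le_one_of_le₀ e1 (by linarith)
      have : 0 < (Real.log 2)⁻¹ := inv_pos.2 hlog2
      linarith

/-- A sequence that is at most `(1 + ε) / d * log T + C √(log T)` for each `ε` is asymptotically at
most `log T / d`. -/
lemma limsup_div_log_le {f : ℕ → ℝ} {d : ℝ} (hd : 0 < d)
    (h : ∀ ε : ℝ, 0 < ε → ∃ C : ℝ, ∀ T : ℕ, 2 ≤ T →
      f T ≤ (1 + ε) / d * Real.log T + C * Real.sqrt (Real.log T)) :
    limsup (fun T : ℕ => ((f T / Real.log T : ℝ) : EReal)) atTop ≤ ((1 / d : ℝ) : EReal) := by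
  have hlog : Tendsto (fun T : ℕ => Real.log T) atTop atTop :=
    Real.tendsto_log_atTop.comp tendsto_natCast_atTop_atTop
  refine EReal.le_of_forall_lt_iff_le.1 fun z hz => ?_
  have hz : 1 / d < z := EReal.coe_lt_coe_iff.1 hz
  -- With this `ε`, `(1 + ε) / d` is the midpoint of `1 / d` and `z`, leaving room for the vanishing
  -- `C / √(log T)`.
  have hε : 0 < (z * d - 1) / 2 := by
    rw [div_lt_iff₀ hd] at hz
    linarith
  obtain ⟨C, hC⟩ := h _ hε
  have hlim : Tendsto (fun T : ℕ => (1 + (z * d - 1) / 2) / d + C / Real.sqrt (Real.log T))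
      atTop (𝓝 ((1 + (z * d - 1) / 2) / d + 0)) :=
    tendsto_const_nhds.add ((Real.tendsto_sqrt_atTop.comp hlog).const_div_atTop C)
  have hlt : (1 + (z * d - 1) / 2) / d + 0 < z := by
    rw [add_zero, div_lt_iff₀ hd]
    linarith
  refine limsup_le_of_le (by isBoundedDefault) ?_
  filter_upwards [hlim.eventually (gt_mem_nhds hlt), eventually_ge_atTop 2,
    hlog.eventually_gt_atTop 0] with T h1 h2 h3
  refine EReal.coe_le_coe_iff.2 (le_trans ?_ h1.le)
  rw [div_le_iff₀ h3]
  refine (hC T h2).trans_eq ?_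
  rw [add_mul, div_mul_eq_mul_div C, mul_div_assoc C, Real.div_sqrt]

end

theorem theorem2 (F : ExpFamily) {K : ℕ} (θ : Fin K → ℝ) (hθ : ∀ i, θ i ∈ F.Θ)
    (c : ℝ) (hc : 7 ≤ c) (a aStar : Fin K)
    (hopt : ∀ i, F.mean (θ i) ≤ F.mean (θ aStar))
    (hsub : F.mean (θ a) < F.mean (θ aStar)) :
    -- the bound at each horizon, for both policies, with a constant that depends only on
    -- `ε` and on the problem
    (∀ ε : ℝ, 0 < ε → ∃ C : ℝ, ∀ (Ω : Type u) [MeasurableSpace Ω] (P : Measure Ω)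
      [IsProbabilityMeasure P] (Y : Fin K → ℕ → Ω → ℝ), IsBandit F θ P Y →
      ∀ T : ℕ, 2 ≤ T → ∀ A : ℕ → Ω → Fin K, (∀ t, Measurable (A t)) →
        (FollowsIndex (klUCBPlusIndex F c Y A) A T ∨
          FollowsIndex (klUCBHPlusIndex F c T Y A) A T) →
        ∫ ω, (pulls A a T ω : ℝ) ∂P ≤
          (1 + ε) / (InformationTheory.klDiv (F.dist (θ a)) (F.dist (θ aStar))).toReal *
            Real.log T + C * Real.sqrt (Real.log T)) ∧
    -- asymptotic optimality of both policies
    (∀ (Ω : Type u) [MeasurableSpace Ω] (P : Measure Ω) [IsProbabilityMeasure P]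
      (Y : Fin K → ℕ → Ω → ℝ), IsBandit F θ P Y →
      (∀ A : ℕ → Ω → Fin K, (∀ t, Measurable (A t)) →
        (∀ T, FollowsIndex (klUCBPlusIndex F c Y A) A T) →
        limsup (fun T : ℕ => (((∫ ω, (pulls A a T ω : ℝ) ∂P) / Real.log T : ℝ) : EReal)) atTop ≤
          ((1 / (InformationTheory.klDiv (F.dist (θ a)) (F.dist (θ aStar))).toReal : ℝ) :
            EReal)) ∧
      (∀ A : ℕ → ℕ → Ω → Fin K, (∀ T t, Measurable (A T t)) →
        (∀ T, FollowsIndex (klUCBHPlusIndex F c T Y (A T)) (A T) T) →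
        limsup (fun T : ℕ =>
            (((∫ ω, (pulls (A T) a T ω : ℝ) ∂P) / Real.log T : ℝ) : EReal)) atTop ≤
          ((1 / (InformationTheory.klDiv (F.dist (θ a)) (F.dist (θ aStar))).toReal : ℝ) :
            EReal))) := by
  have hd : 0 < F.kl (θ a) (θ aStar) := F.kl_pos (hθ a) (hθ aStar) hsub (hθ a) (hθ aStar)
    (F.lt_of_mean_lt (hθ a) (hθ aStar) hsub).ne
  have hbound := fun (ε : ℝ) (hε : 0 < ε) =>
    exists_integral_pulls_le.{u} F θ a aStar hθ (by linarith : (2 : ℝ) ≤ c) hsub hε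
  rw [F.toReal_klDiv (hθ a) (hθ aStar)]
  refine ⟨fun ε hε => ?_, fun Ω _ P _ Y hY => ⟨fun A _ hA => ?_, fun A _ hA => ?_⟩⟩
  · obtain ⟨C, hC⟩ := hbound ε hε
    exact ⟨C, fun Ω _ P _ Y hY T hT A _ hA => hC Ω P Y hY T hT A hA⟩
  · refine limsup_div_log_le hd fun ε hε => ?_
    obtain ⟨C, hC⟩ := hbound ε hε
    exact ⟨C, fun T hT => hC Ω P Y hY T hT A (Or.inl (hA T))⟩
  · refine limsup_div_log_le hd fun ε hε => ?_
    obtain ⟨C, hC⟩ := hbound ε hε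
    exact ⟨C, fun T hT => hC Ω P Y hY T hT (A T) (Or.inr (hA T))⟩
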